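/- Let $N\ge 1$, $0<\lambda\le\Lambda$, and for a symmetric $N\times N$ matrix $X$ let $$\mathcal M^-_{\lambda,\Lambda}(X)=\inf_{\lambda I_N\le A\le\Lambda I_N}-\mathrm{Tr}(AX)=-\Lambda\sum_{e_k>0}e_k-\lambda\sum_{e_k<0}e_k$$ be the minimal Pucci operator, where $e_k$ are the eigenvalues of $X$. Let $b:\mathbb R^N\to\mathbb R^N$ be locally Lipschitz, i.e. for every $R>0$ there is $K_R>0$ with $|b(x)-b(y)|\le K_R|x-y|$ whenever $|x|,|y|\le R$, and assume that $$b(x)\cdot x\le \Lambda-\lambda(N-1)\qquad\text{for all sufficiently large } |x|$$ (this holds in particular if $\limsup_{|x|\to\infty}b(x)\cdot x<\Lambda-\lambda(N-1)$). Let $A,\gamma\in\mathbb R$ satisfy either $A>0$ and $\gamma>0$, or $A\in\mathbb R$ arbitrary and $\gamma=2$. Let $u:\mathbb R^N\to\mathbb R$ be a viscosity supersolution, bounded below, of $$\mathcal M^-_{\lambda,\Lambda}(D^2u)-b(x)\cdot Du=A|Du|^\gamma\quad\text{in }\mathbb R^N,$$ that is, $u$ is lower semicontinuous and, whenever $\varphi$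 is $C^2$ near a point $x_0$ and $u-\varphi$ has a local minimum at $x_0$, one has $\mathcal M^-_{\lambda,\Lambda}(D^2\varphi(x_0))-b(x_0)\cdot D\varphi(x_0)\ge A|D\varphi(x_0)|^\gamma$. Then $u$ is constant. -/

import Mathlib

namespace PucciLiouville

noncomputable section

/-- The symmetric `N × N` real matrices `A` with `lam • I ≤ A ≤ Lam • I`. -/
def ellipticMatrices (N : ℕ) (lam Lam : ℝ) : Set (Matrix (Fin N) (Fin N) ℝ) :=
  {A | (A - lam • (1 : Matrix (Fin N) (Fin N) ℝ)).PosSemidef ∧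
    (Lam • (1 : Matrix (Fin N) (Fin N) ℝ) - A).PosSemidef}

/-- The minimal Pucci operator
`M⁻(X) = inf { -Tr (A X) : lam • I ≤ A ≤ Lam • I }`
(for `0 < lam ≤ Lam` the infimum is over a nonempty compact set of matrices). -/
def pucciMinus {N : ℕ} (lam Lam : ℝ) (X : Matrix (Fin N) (Fin N) ℝ) : ℝ :=
  sInf ((fun A : Matrix (Fin N) (Fin N) ℝ => -(A * X).trace) '' ellipticMatrices N lam Lam)

/-- The Hessian matrix `D²φ(x)`, with entries `∂ᵢ ∂ⱼ φ(x)`. -/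
def hessianMatrix {N : ℕ} (φ : EuclideanSpace ℝ (Fin N) → ℝ) (x : EuclideanSpace ℝ (Fin N)) :
    Matrix (Fin N) (Fin N) ℝ :=
  Matrix.of fun i j =>
    fderiv ℝ (fderiv ℝ φ) x (EuclideanSpace.single i 1) (EuclideanSpace.single j 1)

/-- `u` is a viscosity supersolution of `M⁻(D²u) - b(x) · Du = A |Du|^γ` in `ℝ^N`: it is lower
semicontinuous, and whenever `u - φ` has a local minimum at `x₀`, for a function `φ` that is `C²`
in a neighbourhood of `x₀`, then `M⁻(D²φ(x₀)) - b(x₀) · Dφ(x₀) ≥ A |Dφ(x₀)|^γ`. -/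
def IsViscositySupersolution {N : ℕ} (lam Lam : ℝ)
    (b : EuclideanSpace ℝ (Fin N) → EuclideanSpace ℝ (Fin N)) (A γ : ℝ)
    (u : EuclideanSpace ℝ (Fin N) → ℝ) : Prop :=
  LowerSemicontinuous u ∧
    ∀ (φ : EuclideanSpace ℝ (Fin N) → ℝ) (x₀ : EuclideanSpace ℝ (Fin N)),
      ContDiffAt ℝ 2 φ x₀ → IsLocalMin (fun x => u x - φ x) x₀ →
        A * ‖gradient φ x₀‖ ^ γ ≤
          pucciMinus lam Lam (hessianMatrix φ x₀) - inner ℝ (b x₀) (gradient φ x₀)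

end

end PucciLiouville

namespace PucciLiouville

open Matrix Topology Filter

variable {N : ℕ}

/-! Testing the infimum in the Pucci operator with one matrix `M` turns `u` into a supersolution of
`-Tr (M D²v) - b · Dv = 0` for every elliptic `M`. If `A > 0` the gradient term is dropped; if `γ =
2` it is absorbed by passing to `-exp (-c u)` (`hopfCole`). Such a `v`, bounded below, attains its
infimum: outside a large ball the drift condition makes `log |x|² - |x|⁻²` a strict supersolution
for a suitable `M`, and it tends to infinity (`exists_forall_le`). The strong minimum principle then
makes `v` constant (`eq_of_forall_le`); there `b` need only be locally bounded. -/

/-! ### Elliptic matrices -/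

theorem abs_apply_le_of_mem_ellipticMatrices {lam Lam : ℝ} (hlam : 0 < lam)
    {M : Matrix (Fin N) (Fin N) ℝ} (hM : M ∈ ellipticMatrices N lam Lam) (i j : Fin N) :
    |M i j| ≤ Lam := by
  obtain ⟨h1, h2⟩ := hM
  have hsymm : M j i = M i j := by
    by_cases hij : i = j
    · rw [hij]
    · have h := h1.1.apply i j
      simpa [hij, Ne.symm hij] using h
  have hdiag : ∀ k, M k k ≤ Lam := fun k => by simpa using h2.diag_nonneg (i := k)
  have hquad : ∀ t : ℝ, 0 ≤ M i i + t * M i j + t * (M j i + t * M j j) := fun t => by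
    have hp : M.PosSemidef := by
      have := h1.add ((PosSemidef.one (n := Fin N) (R := ℝ)).smul hlam.le)
      simpa using this
    have h := hp.dotProduct_mulVec_nonneg (Pi.single i 1 + t • Pi.single j 1)
    simp only [star_trivial, mulVec_add, mulVec_smul, mulVec_single_one, dotProduct_add,
      add_dotProduct, smul_dotProduct, dotProduct_smul, single_one_dotProduct, smul_eq_mul,
      col_apply] at h
    linarith
  -- Positivity at `eᵢ ± eⱼ` bounds `∓2 Mᵢⱼ` by the two diagonal entries.
  have hp := hquad 1
  have hn := hquad (-1)
  have hi := hdiag i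
  have hj := hdiag j
  rw [abs_le]
  constructor <;> linarith

theorem pucciMinus_le_neg_trace {lam Lam : ℝ} (hlam : 0 < lam)
    {M : Matrix (Fin N) (Fin N) ℝ} (hM : M ∈ ellipticMatrices N lam Lam)
    (X : Matrix (Fin N) (Fin N) ℝ) : pucciMinus lam Lam X ≤ -(M * X).trace := by
  refine csInf_le ⟨-∑ i, ∑ j, Lam * |X j i|, ?_⟩ ⟨M, hM, rfl⟩
  rintro _ ⟨B, hB, rfl⟩
  simp only [trace, diag_apply, mul_apply]
  refine neg_le_neg (Finset.sum_le_sum fun i _ => Finset.sum_le_sum fun j _ => ?_)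
  refine (le_abs_self _).trans ?_
  rw [abs_mul]
  exact mul_le_mul_of_nonneg_right (abs_apply_le_of_mem_ellipticMatrices hlam hB i j)
    (abs_nonneg _)

theorem mul_dotProduct_le_of_mem_ellipticMatrices {lam Lam : ℝ}
    {M : Matrix (Fin N) (Fin N) ℝ} (hM : M ∈ ellipticMatrices N lam Lam) (p : Fin N → ℝ) :
    lam * (p ⬝ᵥ p) ≤ p ⬝ᵥ (M *ᵥ p) := by
  have h := hM.1.dotProduct_mulVec_nonneg p
  simp only [star_trivial, sub_mulVec, smul_mulVec, one_mulVec, dotProduct_sub,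
    dotProduct_smul, smul_eq_mul] at h
  linarith

theorem smul_one_mem_ellipticMatrices {lam Lam : ℝ} (hLam : lam ≤ Lam) :
    Lam • (1 : Matrix (Fin N) (Fin N) ℝ) ∈ ellipticMatrices N lam Lam := by
  constructor
  · rw [← sub_smul]
    exact PosSemidef.one.smul (sub_nonneg.2 hLam)
  · rw [sub_self]
    exact PosSemidef.zero

/-- The elliptic matrix with eigenvalue `Lam` in the direction `p` and `lam` orthogonally to it. -/
theorem smul_one_add_smul_vecMulVec_mem_ellipticMatrices {lam Lam : ℝ} (hLam : lam ≤ Lam)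
    {p : Fin N → ℝ} (hp : 0 < p ⬝ᵥ p) :
    lam • (1 : Matrix (Fin N) (Fin N) ℝ) + ((Lam - lam) / (p ⬝ᵥ p)) • vecMulVec p p ∈
      ellipticMatrices N lam Lam := by
  have hvec : (vecMulVec p p).PosSemidef := by
    simpa using posSemidef_vecMulVec_self_star p
  constructor
  · rw [add_sub_cancel_left]
    exact hvec.smul (div_nonneg (sub_nonneg.2 hLam) hp.le)
  · have h : (Lam • (1 : Matrix (Fin N) (Fin N) ℝ) -
        (lam • 1 + ((Lam - lam) / (p ⬝ᵥ p)) • vecMulVec p p)) =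
        ((Lam - lam) / (p ⬝ᵥ p)) • ((p ⬝ᵥ p) • 1 - vecMulVec p p) := by
      rw [smul_sub, smul_smul, div_mul_cancel₀ _ hp.ne', sub_smul]
      abel
    rw [h]
    refine PosSemidef.smul ?_ (div_nonneg (sub_nonneg.2 hLam) hp.le)
    refine .of_dotProduct_mulVec_nonneg ?_ fun x => ?_
    · exact (isHermitian_one.smul (IsSelfAdjoint.all _)).sub hvec.1
    · simp only [star_trivial, sub_mulVec, smul_mulVec, one_mulVec, dotProduct_sub,
        dotProduct_smul, smul_eq_mul, vecMulVec_mulVec, op_smul_eq_smul]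
      have h := Finset.sum_mul_sq_le_sq_mul_sq Finset.univ p x
      simp only [dotProduct, sub_nonneg]
      simp only [sq] at h
      convert h using 2
      exact Finset.sum_congr rfl fun i _ => mul_comm _ _

theorem trace_mul_vecMulVec_self (M : Matrix (Fin N) (Fin N) ℝ) (p : Fin N → ℝ) :
    (M * vecMulVec p p).trace = p ⬝ᵥ (M *ᵥ p) := by
  rw [mul_vecMulVec, trace_vecMulVec, dotProduct_comm]

/-! ### Derivatives of composed and radial test functions -/

theorem fderiv_fderiv_comp {E : Type*} [NormedAddCommGroup E] [NormedSpace ℝ E]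
    {ψ : E → ℝ} {x : E} {g g' : ℝ → ℝ} {g'' : ℝ} (hψ : ContDiffAt ℝ 2 ψ x)
    (hg : ∀ᶠ s in 𝓝 (ψ x), HasDerivAt g (g' s) s) (hg' : HasDerivAt g' g'' (ψ x)) (v w : E) :
    fderiv ℝ (fderiv ℝ fun y => g (ψ y)) x v w =
      g' (ψ x) * fderiv ℝ (fderiv ℝ ψ) x v w + g'' * (fderiv ℝ ψ x v * fderiv ℝ ψ x w) := by
  have hd : ∀ᶠ y in 𝓝 x, DifferentiableAt ℝ ψ y :=
    (hψ.eventually (by simp)).mono fun y hy => hy.differentiableAt (by simp)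
  have he : (fderiv ℝ fun y => g (ψ y)) =ᶠ[𝓝 x] fun y => g' (ψ y) • fderiv ℝ ψ y := by
    filter_upwards [hd, hψ.continuousAt.eventually hg] with y hy hgy
    exact (hgy.comp_hasFDerivAt y hy.hasFDerivAt).fderiv
  have h2 : DifferentiableAt ℝ (fderiv ℝ ψ) x :=
    (hψ.fderiv_right (m := 1) (by norm_num)).differentiableAt (by simp)
  have h1 := hg'.comp_hasFDerivAt x hd.self_of_nhds.hasFDerivAt
  have h3 : HasFDerivAt (fun y => g' (ψ y) • fderiv ℝ ψ y) _ x := h1.smul h2.hasFDerivAt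
  rw [he.fderiv_eq, h3.fderiv]
  simp
  ring

theorem fderiv_single_eq_gradient (φ : EuclideanSpace ℝ (Fin N) → ℝ)
    (x : EuclideanSpace ℝ (Fin N)) (i : Fin N) :
    fderiv ℝ φ x (EuclideanSpace.single i 1) = gradient φ x i := by
  rw [← toDual_gradient, InnerProductSpace.toDual_apply_apply, EuclideanSpace.inner_single_right]
  simp

theorem hessianMatrix_comp {ψ : EuclideanSpace ℝ (Fin N) → ℝ} {x : EuclideanSpace ℝ (Fin N)}
    {g g' : ℝ → ℝ} {g'' : ℝ} (hψ : ContDiffAt ℝ 2 ψ x)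
    (hg : ∀ᶠ s in 𝓝 (ψ x), HasDerivAt g (g' s) s) (hg' : HasDerivAt g' g'' (ψ x)) :
    hessianMatrix (fun y => g (ψ y)) x =
      g' (ψ x) • hessianMatrix ψ x + g'' • vecMulVec (gradient ψ x).ofLp (gradient ψ x).ofLp := by
  ext i j
  simp only [hessianMatrix, of_apply, fderiv_fderiv_comp hψ hg hg', Matrix.add_apply,
    Matrix.smul_apply, smul_eq_mul, vecMulVec_apply, fderiv_single_eq_gradient]

theorem gradient_comp {ψ : EuclideanSpace ℝ (Fin N) → ℝ} {x : EuclideanSpace ℝ (Fin N)}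
    {g : ℝ → ℝ} {g' : ℝ} (hψ : DifferentiableAt ℝ ψ x) (hg : HasDerivAt g g' (ψ x)) :
    gradient (fun y => g (ψ y)) x = g' • gradient ψ x := by
  have h : HasFDerivAt (fun y => g (ψ y)) (g' • fderiv ℝ ψ x) x :=
    hg.comp_hasFDerivAt x hψ.hasFDerivAt
  rw [gradient, gradient, h.fderiv, map_smul]

theorem fderiv_norm_sub_sq {E : Type*} [NormedAddCommGroup E] [InnerProductSpace ℝ E] (y : E) :
    (fderiv ℝ fun x : E => ‖x - y‖ ^ 2) = fun x => 2 • innerSL ℝ (x - y) := by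
  ext1 x
  have h := ((hasFDerivAt_id x).sub_const y).norm_sq
  exact h.fderiv

theorem gradient_norm_sub_sq (x y : EuclideanSpace ℝ (Fin N)) :
    gradient (fun x => ‖x - y‖ ^ 2) x = (2 : ℝ) • (x - y) := by
  refine ext_inner_right ℝ fun v => ?_
  rw [gradient, InnerProductSpace.toDual_symm_apply, fderiv_norm_sub_sq]
  rw [inner_smul_left]
  simp only [_root_.smul_apply, innerSL_apply_apply, nsmul_eq_mul]
  simp

theorem hessianMatrix_norm_sub_sq (x y : EuclideanSpace ℝ (Fin N)) :
    hessianMatrix (fun x => ‖x - y‖ ^ 2) x = (2 : ℝ) • 1 := by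
  ext i j
  have h : HasFDerivAt (fun x : EuclideanSpace ℝ (Fin N) => 2 • innerSL ℝ (x - y))
      (2 • innerSL ℝ) x :=
    ((innerSL ℝ).hasFDerivAt.comp x ((hasFDerivAt_id x).sub_const y)).const_smul 2
  simp only [hessianMatrix, of_apply, fderiv_norm_sub_sq]
  rw [h.fderiv]
  change (2 • inner ℝ (EuclideanSpace.single i (1 : ℝ)) (EuclideanSpace.single j (1 : ℝ)) : ℝ) = _
  rw [EuclideanSpace.inner_single_left]
  simp [Matrix.one_apply]

/-! ### Reduction to linear supersolutions -/

/-- `v` satisfies `-Tr (M D²v) - b · Dv ≥ 0` in the viscosity sense, for every elliptic `M`. -/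
def IsLinearSupersolution (lam Lam : ℝ)
    (b : EuclideanSpace ℝ (Fin N) → EuclideanSpace ℝ (Fin N))
    (v : EuclideanSpace ℝ (Fin N) → ℝ) : Prop :=
  ∀ (φ : EuclideanSpace ℝ (Fin N) → ℝ) (x₀ : EuclideanSpace ℝ (Fin N)),
    ContDiffAt ℝ 2 φ x₀ → IsLocalMin (fun x => v x - φ x) x₀ →
      ∀ M ∈ ellipticMatrices N lam Lam,
        0 ≤ -(M * hessianMatrix φ x₀).trace - inner ℝ (b x₀) (gradient φ x₀)

variable {lam Lam A γ : ℝ} {b : EuclideanSpace ℝ (Fin N) → EuclideanSpace ℝ (Fin N)}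
  {u v : EuclideanSpace ℝ (Fin N) → ℝ}

theorem IsViscositySupersolution.isLinearSupersolution (hlam : 0 < lam) (hA : 0 ≤ A)
    (hu : IsViscositySupersolution lam Lam b A γ u) : IsLinearSupersolution lam Lam b u := by
  intro φ x₀ hφ hmin M hM
  have h := hu.2 φ x₀ hφ hmin
  have h1 := pucciMinus_le_neg_trace hlam hM (hessianMatrix φ x₀)
  have h2 : 0 ≤ A * ‖gradient φ x₀‖ ^ γ := by positivity
  linarith

theorem dotProduct_self_eq_norm_sq (p : EuclideanSpace ℝ (Fin N)) :
    p.ofLp ⬝ᵥ p.ofLp = ‖p‖ ^ 2 := by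
  rw [EuclideanSpace.real_norm_sq_eq]
  exact Finset.sum_congr rfl fun i _ => (sq _).symm

/-- The Hopf–Cole transform of a supersolution with quadratic gradient term. -/
theorem IsViscositySupersolution.hopfCole (hlam : 0 < lam)
    (hu : IsViscositySupersolution lam Lam b A 2 u) {c : ℝ} (hc : 0 < c) (hAc : |A| ≤ c * lam) :
    IsLinearSupersolution lam Lam b fun x => -Real.exp (-c * u x) := by
  intro ψ x₀ hψ hmin M hM
  set E := Real.exp (-c * u x₀) with hE
  have hEpos : 0 < E := Real.exp_pos _
  -- The shift makes `ψ + k` touch `-exp (-c u)` from below at `x₀`.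
  set k := -E - ψ x₀ with hk
  have hval : ψ x₀ + k = -E := by rw [hk]; ring
  have hne : ∀ᶠ s in 𝓝 (ψ x₀), s + k ≠ 0 :=
    (continuousAt_id.add continuousAt_const).eventually_ne (by
      simpa [hval] using hEpos.ne')
  have hne₀ : ψ x₀ + k ≠ 0 := by rw [hval]; exact (neg_neg_of_pos hEpos).ne
  -- This inverts `t ↦ -exp (-c t)`: near `ψ x₀` the argument is negative, and `Real.log` reads its
  -- absolute value.
  set g : ℝ → ℝ := fun s => -c⁻¹ * Real.log (s + k) with hgdef
  set g' : ℝ → ℝ := fun s => -c⁻¹ * (s + k)⁻¹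
  have hg : ∀ᶠ s in 𝓝 (ψ x₀), HasDerivAt g (g' s) s := by
    filter_upwards [hne] with s hs
    have := (((hasDerivAt_id s).add_const k).log hs).const_mul (-c⁻¹)
    simpa [g, g', one_div] using this
  have hg' : HasDerivAt g' (c⁻¹ * (E ^ 2)⁻¹) (ψ x₀) := by
    have := (((hasDerivAt_id (ψ x₀)).add_const k).inv hne₀).const_mul (-c⁻¹)
    refine this.congr_deriv ?_
    simp only [id, hval]
    field_simp
  have hgC : ContDiffAt ℝ 2 g (ψ x₀) := by
    have : ContDiffAt ℝ 2 (fun s => s + k) (ψ x₀) := by fun_prop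
    exact contDiffAt_const.mul (this.log hne₀)
  have hg'₀ : g' (ψ x₀) = c⁻¹ * E⁻¹ := by
    simp only [g', hval]
    rw [inv_neg]
    ring
  have hloc : IsLocalMin (fun x => u x - g (ψ x)) x₀ := by
    filter_upwards [hmin] with x hx
    have h1 : Real.exp (-c * u x) ≤ -(ψ x + k) := by
      simp only [← hE] at hx
      linarith
    have h2 := Real.log_le_log (Real.exp_pos _) h1
    rw [Real.log_exp, Real.log_neg_eq_log] at h2
    simp only [hgdef, hval, Real.log_neg_eq_log, hE, Real.log_exp]
    have h3 := mul_le_mul_of_nonneg_left h2 (inv_nonneg.2 hc.le)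
    have h4 : ∀ t : ℝ, c⁻¹ * (-c * t) = -t := fun t => by field_simp
    rw [h4] at h3
    have h5 := h4 (u x₀)
    linarith
  have h := hu.2 (fun x => g (ψ x)) x₀ (hgC.comp x₀ hψ) hloc
  have h1 := pucciMinus_le_neg_trace hlam hM (hessianMatrix (fun x => g (ψ x)) x₀)
  rw [gradient_comp (hψ.differentiableAt (by simp)) hg.self_of_nhds] at h
  rw [hessianMatrix_comp hψ hg hg'] at h h1
  rw [Matrix.mul_add, trace_add, Matrix.mul_smul, Matrix.mul_smul, trace_smul, trace_smul,
    trace_mul_vecMulVec_self] at h1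
  have h2 := mul_dotProduct_le_of_mem_ellipticMatrices hM (gradient ψ x₀).ofLp
  rw [dotProduct_self_eq_norm_sq] at h2
  rw [hg'₀] at h h1
  rw [norm_smul, inner_smul_right, Real.rpow_two, mul_pow, Real.norm_eq_abs, sq_abs] at h
  simp only [smul_eq_mul] at h1
  set P := ‖gradient ψ x₀‖ ^ 2
  have hP : 0 ≤ P := by positivity
  have h5 : 0 ≤ A * P + c * (lam * P) := by
    have : 0 ≤ (A + c * lam) * P := mul_nonneg (by linarith [neg_abs_le A]) hP
    linarith
  have h6 := mul_le_mul_of_nonneg_left h2 (by positivity : 0 ≤ c⁻¹ * (E ^ 2)⁻¹)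
  have h7 := h.trans (sub_le_sub_right h1 _)
  have h8 : 0 ≤ (c⁻¹ * E⁻¹) * (-(M * hessianMatrix ψ x₀).trace -
      inner ℝ (b x₀) (gradient ψ x₀)) := by
    -- The `g''` term contributes at least `c⁻¹ E⁻² lam P`, which compensates `A |Dφ|²` because `|A|
    -- ≤ c lam`.
    have h9 : 0 ≤ (c⁻¹ * E⁻¹) ^ 2 * (A * P + c * (lam * P)) := by positivity
    have h10 : (c⁻¹ * E⁻¹) ^ 2 * (A * P + c * (lam * P)) =
        A * ((c⁻¹ * E⁻¹) ^ 2 * P) + c⁻¹ * (E ^ 2)⁻¹ * (lam * P) := by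
      field_simp
    rw [h10] at h9
    linarith
  exact nonneg_of_mul_nonneg_right h8 (by positivity)

theorem IsLinearSupersolution.radial_test (hv : IsLinearSupersolution lam Lam b v)
    {x₀ y : EuclideanSpace ℝ (Fin N)} {g g' : ℝ → ℝ} {g'' : ℝ}
    (hgC : ContDiffAt ℝ 2 g (‖x₀ - y‖ ^ 2))
    (hg : ∀ᶠ s in 𝓝 (‖x₀ - y‖ ^ 2), HasDerivAt g (g' s) s)
    (hg' : HasDerivAt g' g'' (‖x₀ - y‖ ^ 2))
    (hmin : IsLocalMin (fun x => v x - g (‖x - y‖ ^ 2)) x₀)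
    {M : Matrix (Fin N) (Fin N) ℝ} (hM : M ∈ ellipticMatrices N lam Lam) :
    2 * g' (‖x₀ - y‖ ^ 2) * M.trace + 4 * g'' * ((x₀ - y).ofLp ⬝ᵥ (M *ᵥ (x₀ - y).ofLp)) +
      2 * g' (‖x₀ - y‖ ^ 2) * inner ℝ (b x₀) (x₀ - y) ≤ 0 := by
  have hψ : ContDiffAt ℝ 2 (fun x : EuclideanSpace ℝ (Fin N) => ‖x - y‖ ^ 2) x₀ :=
    (contDiff_id.sub contDiff_const).norm_sq ℝ |>.contDiffAt
  have h := hv (fun x => g (‖x - y‖ ^ 2)) x₀ (hgC.comp x₀ hψ) hmin M hM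
  rw [gradient_comp (ψ := fun x => ‖x - y‖ ^ 2) (hψ.differentiableAt (by simp))
    hg.self_of_nhds, hessianMatrix_comp (ψ := fun x => ‖x - y‖ ^ 2) hψ hg hg',
    gradient_norm_sub_sq, hessianMatrix_norm_sub_sq] at h
  simp only [Matrix.mul_add, trace_add, Matrix.mul_smul, trace_smul, mul_one,
    trace_mul_vecMulVec_self, smul_eq_mul, inner_smul_right, WithLp.ofLp_smul, mulVec_smul,
    dotProduct_smul, smul_dotProduct] at h
  linarith

/-! ### Comparison on annuli -/

/-- Strictness on both spheres keeps a minimiser over the compact annulus off its boundary. -/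
theorem exists_isLocalMin_of_annulus {E : Type*} [NormedAddCommGroup E] [ProperSpace E]
    {w : E → ℝ} {y x₁ : E} {r₁ r₂ : ℝ}
    (hw : LowerSemicontinuousOn w {x | r₁ ≤ ‖x - y‖ ∧ ‖x - y‖ ≤ r₂})
    (h₁ : r₁ ≤ ‖x₁ - y‖) (h₂ : ‖x₁ - y‖ ≤ r₂)
    (hin : ∀ x, ‖x - y‖ = r₁ → w x₁ < w x) (hout : ∀ x, ‖x - y‖ = r₂ → w x₁ < w x) :
    ∃ x₀, r₁ < ‖x₀ - y‖ ∧ ‖x₀ - y‖ < r₂ ∧ IsLocalMin w x₀ := by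
  have hcont : Continuous fun x : E => ‖x - y‖ := by fun_prop
  have hcomp : IsCompact {x : E | r₁ ≤ ‖x - y‖ ∧ ‖x - y‖ ≤ r₂} := by
    refine (isCompact_closedBall y r₂).of_isClosed_subset
      ((isClosed_le continuous_const hcont).inter (isClosed_le hcont continuous_const)) ?_
    intro x hx
    rw [mem_closedBall_iff_norm]
    exact hx.2
  have hne : {x : E | r₁ ≤ ‖x - y‖ ∧ ‖x - y‖ ≤ r₂}.Nonempty := ⟨x₁, h₁, h₂⟩
  obtain ⟨x₀, hx₀, hmin⟩ := hw.exists_isMinOn hne hcomp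
  have hle : w x₀ ≤ w x₁ := isMinOn_iff.1 hmin x₁ ⟨h₁, h₂⟩
  have hlt₁ : r₁ < ‖x₀ - y‖ := hx₀.1.lt_of_ne fun h => (hin x₀ h.symm).not_ge hle
  have hlt₂ : ‖x₀ - y‖ < r₂ := hx₀.2.lt_of_ne fun h => (hout x₀ h).not_ge hle
  refine ⟨x₀, hlt₁, hlt₂, hmin.isLocalMin ?_⟩
  filter_upwards [hcont.continuousAt.eventually_const_lt hlt₁,
    hcont.continuousAt.eventually_lt_const hlt₂] with x hx1 hx2
  exact ⟨hx1.le, hx2.le⟩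

/-- Comparison with the Lyapunov function `log |x|² - |x|⁻²`: a linear supersolution that is
bounded below attains its infimum. -/
theorem IsLinearSupersolution.exists_forall_le (hlam : 0 < lam) (hLam : lam ≤ Lam)
    (hv : IsLinearSupersolution lam Lam b v) (hlsc : LowerSemicontinuous v)
    (hbdd : ∃ m : ℝ, ∀ x, m ≤ v x)
    (hdrift : ∃ R₀ : ℝ, ∀ x : EuclideanSpace ℝ (Fin N), R₀ ≤ ‖x‖ →
      inner ℝ (b x) x ≤ Lam - lam * ((N : ℝ) - 1)) :
    ∃ x₀, ∀ x, v x₀ ≤ v x := by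
  obtain ⟨m, hm⟩ := hbdd
  obtain ⟨R₀, hdrift⟩ := hdrift
  -- The `1` keeps the annulus away from the singularity of `h` at the origin.
  set R := max R₀ 1
  have hR : 0 < R := lt_max_of_lt_right one_pos
  obtain ⟨z, hz, hzmin⟩ := (hlsc.lowerSemicontinuousOn
    (Metric.closedBall (0 : EuclideanSpace ℝ (Fin N)) R)).exists_isMinOn
    ⟨0, Metric.mem_closedBall_self hR.le⟩ (isCompact_closedBall _ _)
  have hzmin' : ∀ x, ‖x‖ ≤ R → v z ≤ v x := fun x hx =>
    isMinOn_iff.1 hzmin x (mem_closedBall_zero_iff.2 hx)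
  refine ⟨z, fun x₁ => ?_⟩
  by_contra! hlt
  have hx₁ : R < ‖x₁‖ := by
    by_contra! h
    exact (hzmin' x₁ h).not_gt hlt
  set h : ℝ → ℝ := fun s => Real.log s - s⁻¹ with hh
  -- The gap `v z - v x₁` leaves room for a small multiple of `h` on the inner sphere; growth of `h`
  -- and `m ≤ v` handle the outer one.
  obtain ⟨ε, hε, hεlt⟩ : ∃ ε : ℝ, 0 < ε ∧ v x₁ + ε * h (‖x₁‖ ^ 2) < v z + ε * h (R ^ 2) := by
    set H := h (‖x₁‖ ^ 2) - h (R ^ 2) with hH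
    have hd : 0 < v z - v x₁ := sub_pos.2 hlt
    refine ⟨(v z - v x₁) / (|H| + 1), by positivity, ?_⟩
    have h1 : (v z - v x₁) / (|H| + 1) * H < v z - v x₁ := by
      rw [div_mul_eq_mul_div, div_lt_iff₀ (by positivity)]
      exact mul_lt_mul_of_pos_left (by linarith [le_abs_self H]) hd
    rw [hH, mul_sub] at h1
    linarith
  have htend : Tendsto (fun r : ℝ => m + ε * h (r ^ 2)) atTop atTop := by
    have h1 : Tendsto h atTop atTop := by
      have := Real.tendsto_log_atTop.atTop_add (tendsto_inv_atTop_zero (𝕜 := ℝ)).neg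
      simpa [hh, sub_eq_add_neg] using this
    exact tendsto_atTop_add_const_left _ _
      ((h1.comp (tendsto_pow_atTop two_ne_zero)).const_mul_atTop hε)
  obtain ⟨r, hr, hr₁⟩ := ((htend.eventually_gt_atTop (v x₁ + ε * h (‖x₁‖ ^ 2))).and
    (eventually_ge_atTop ‖x₁‖)).exists
  set g : ℝ → ℝ := fun s => -ε * h s with hgdef
  obtain ⟨x₀, hx₀, -, hmin⟩ := exists_isLocalMin_of_annulus (y := 0) (x₁ := x₁)
    (w := fun x => v x - g (‖x - 0‖ ^ 2)) (r₁ := R) (r₂ := r)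
    (by
      simp only [sub_eq_add_neg (v _)]
      refine (hlsc.lowerSemicontinuousOn _).add (ContinuousOn.lowerSemicontinuousOn ?_)
      have hne : ∀ x ∈ {x : EuclideanSpace ℝ (Fin N) | R ≤ ‖x - 0‖ ∧ ‖x - 0‖ ≤ r},
          ‖x - 0‖ ^ 2 ≠ 0 := fun x hx => (pow_pos (hR.trans_le hx.1) 2).ne'
      have hc : ContinuousOn (fun x : EuclideanSpace ℝ (Fin N) => ‖x - 0‖ ^ 2)
        {x | R ≤ ‖x - 0‖ ∧ ‖x - 0‖ ≤ r} := by fun_prop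
      exact (continuousOn_const.mul ((hc.log hne).sub (hc.inv₀ hne))).neg)
    (by simpa using hx₁.le) (by simpa using hr₁)
    (fun x hx => by
      rw [sub_zero] at hx
      have := hzmin' x hx.le
      simp only [hgdef, sub_zero, hx]
      linarith)
    (fun x hx => by
      rw [sub_zero] at hx
      have := hm x
      simp only [hgdef, sub_zero, hx]
      linarith)
  rw [sub_zero] at hx₀
  have hnorm : 0 < ‖x₀‖ := hR.trans hx₀
  set s := ‖x₀‖ ^ 2 with hs
  have hspos : 0 < s := by positivity
  have hdot : (x₀ - 0).ofLp ⬝ᵥ (x₀ - 0).ofLp = s := by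
    rw [dotProduct_self_eq_norm_sq, sub_zero]
  have hs0 : ‖x₀ - 0‖ ^ 2 = s := by rw [sub_zero]
  -- Eigenvalue `Lam` in the radial direction, where `log |x|²` is concave, matches the constant in
  -- the drift condition.
  have hM := smul_one_add_smul_vecMulVec_mem_ellipticMatrices hLam (hdot ▸ hspos)
  have htest := hv.radial_test (y := 0) (g := g) (g' := fun t => -ε * (t⁻¹ + (t ^ 2)⁻¹))
    (g'' := ε * ((s ^ 2)⁻¹ + 2 * (s ^ 3)⁻¹))
    (by
      rw [hs0]
      exact contDiffAt_const.mul
        ((Real.contDiffAt_log.2 hspos.ne').sub (contDiffAt_inv ℝ hspos.ne')))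
    (by
      rw [hs0]
      filter_upwards [eventually_ne_nhds hspos.ne'] with t ht
      refine (((Real.hasDerivAt_log ht).sub (hasDerivAt_inv ht)).const_mul (-ε)).congr_deriv ?_
      ring)
    (by
      rw [hs0]
      have h1 := (((hasDerivAt_inv hspos.ne').add
        ((hasDerivAt_pow 2 s).inv (pow_ne_zero 2 hspos.ne')))).const_mul (-ε)
      refine h1.congr_deriv ?_
      field_simp
      ring)
    hmin hM
  have hb := hdrift x₀ ((le_max_left _ _).trans hx₀.le)
  simp only [add_mulVec, smul_mulVec, one_mulVec, vecMulVec_mulVec, op_smul_eq_smul,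
    dotProduct_add, dotProduct_smul, trace_add, trace_smul, trace_one, trace_vecMulVec, hdot,
    smul_eq_mul, Fintype.card_fin, hs0] at htest
  rw [sub_zero] at htest
  have h1 : (Lam - lam) / s * s = Lam - lam := div_mul_cancel₀ _ hspos.ne'
  have h2 : (Lam - lam) / s * (s * s) = (Lam - lam) * s := by field_simp
  rw [h1, h2] at htest
  have h3 : 0 ≤ 2 * ε * (s⁻¹ + (s ^ 2)⁻¹) * (Lam - lam * ((N : ℝ) - 1) - inner ℝ (b x₀) x₀) :=
    mul_nonneg (by positivity) (sub_nonneg.2 hb)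
  have hLpos : 0 < Lam := hlam.trans_le hLam
  -- The drift condition may hold with equality; this strict surplus comes from the `-|x|⁻²`
  -- correction.
  have h4 : 0 < 4 * ε * Lam * (s ^ 2)⁻¹ := by positivity
  have h5 : 4 * (ε * ((s ^ 2)⁻¹ + 2 * (s ^ 3)⁻¹)) * (lam * s + (Lam - lam) * s) =
      4 * ε * Lam * (s⁻¹ + 2 * (s ^ 2)⁻¹) := by
    field_simp
    ring
  rw [h5] at htest
  linarith

/-- Comparison with a Hopf barrier: a linear supersolution that attains its infimum is constant. -/
theorem IsLinearSupersolution.eq_of_forall_le (hlam : 0 < lam) (hLam : lam ≤ Lam)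
    (hv : IsLinearSupersolution lam Lam b v) (hlsc : LowerSemicontinuous v)
    (hb : ∀ R : ℝ, 0 < R → ∃ K : ℝ, ∀ x, ‖x‖ ≤ R → ‖b x‖ ≤ K)
    {x₀ : EuclideanSpace ℝ (Fin N)} (hx₀ : ∀ x, v x₀ ≤ v x) (y : EuclideanSpace ℝ (Fin N)) :
    v y = v x₀ := by
  by_contra hne
  set m := v x₀
  have hy : m < v y := (hx₀ y).lt_of_ne' hne
  have hZ : IsClosed {x | v x ≤ m} := hlsc.isClosed_preimage m
  have hZne : {x | v x ≤ m}.Nonempty := ⟨x₀, le_refl m⟩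
  -- A point of the minimum set nearest to `y`: `v > m` in the open ball of radius `d` about `y`.
  obtain ⟨z, hz, hzd⟩ := hZ.exists_infDist_eq_dist hZne y
  set d := Metric.infDist y {x | v x ≤ m}
  have hd : 0 < d := (hZ.notMem_iff_infDist_pos hZne).1 hy.not_ge
  have hzd' : ‖z - y‖ = d := by rw [← dist_eq_norm, dist_comm, hzd]
  have hzm : v z = m := le_antisymm hz (hx₀ z)
  have hball : ∀ x, ‖x - y‖ < d → m < v x := fun x hx => by
    by_contra! h
    rw [← dist_eq_norm, dist_comm] at hx
    exact (Metric.infDist_le_dist_of_mem (s := {x | v x ≤ m}) h).not_gt hx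
  obtain ⟨K, hK⟩ := hb (‖y‖ + 2 * d) (by positivity)
  have hK0 : 0 ≤ K := (norm_nonneg _).trans (hK y (by linarith))
  obtain ⟨q, hq, hqmin⟩ := (hlsc.lowerSemicontinuousOn
    (Metric.closedBall y (d / 2))).exists_isMinOn
    ⟨y, Metric.mem_closedBall_self (by positivity)⟩ (isCompact_closedBall _ _)
  have hqm : m < v q := hball q (by
    rw [mem_closedBall_iff_norm] at hq
    linarith)
  have hLpos : 0 < Lam := hlam.trans_le hLam
  -- Below the gap on the inner sphere, so the barrier `g ≤ ε` leaves `v - g > m` there.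
  set ε := (v q - m) / 2 with hε
  have hεpos : 0 < ε := half_pos (sub_pos.2 hqm)
  -- Large enough that, for `s ≥ d² / 4`, the second-order term beats trace and drift; the `1` gives
  -- strictness.
  set α := 2 * (Lam * N + 2 * d * K + 1) / (Lam * d ^ 2) with hα
  have hαpos : 0 < α := by positivity
  set g : ℝ → ℝ := fun s => ε * Real.exp (-α * s) with hgdef
  have hg : ∀ s, HasDerivAt g (-(ε * α) * Real.exp (-α * s)) s := fun s => by
    refine ((((hasDerivAt_id s).const_mul (-α)).exp).const_mul ε).congr_deriv ?_
    simp only [id]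
    ring
  obtain ⟨x₁, hx₁, hx₁', hmin⟩ := exists_isLocalMin_of_annulus (y := y) (x₁ := z)
    (w := fun x => v x - g (‖x - y‖ ^ 2)) (r₁ := d / 2) (r₂ := 2 * d)
    (by
      simp only [sub_eq_add_neg (v _)]
      refine (hlsc.lowerSemicontinuousOn _).add (ContinuousOn.lowerSemicontinuousOn ?_)
      fun_prop)
    (by linarith) (by linarith)
    (fun x hx => by
      have h1 : v q ≤ v x := isMinOn_iff.1 hqmin x (mem_closedBall_iff_norm.2 hx.le)
      have h2 : g (‖x - y‖ ^ 2) ≤ ε := by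
        refine mul_le_of_le_one_right hεpos.le (Real.exp_le_one_iff.2 ?_)
        rw [neg_mul]
        exact neg_nonpos.2 (by positivity)
      have h3 : 0 < g (‖z - y‖ ^ 2) := mul_pos hεpos (Real.exp_pos _)
      simp only [hzm]
      linarith)
    -- Beyond `z` only `v ≥ m` and the radial decay of `g` are needed.
    (fun x hx => by
      have h1 : g (‖x - y‖ ^ 2) < g (‖z - y‖ ^ 2) := by
        refine mul_lt_mul_of_pos_left (Real.exp_lt_exp.2 ?_) hεpos
        rw [hx, hzd', neg_mul, neg_mul, neg_lt_neg_iff]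
        refine mul_lt_mul_of_pos_left ?_ hαpos
        nlinarith
      have h2 := hx₀ x
      simp only [hzm]
      linarith)
  set s := ‖x₁ - y‖ ^ 2 with hs
  have htest := hv.radial_test (y := y) (g := g) (g' := fun t => -(ε * α) * Real.exp (-α * t))
    (g'' := ε * α ^ 2 * Real.exp (-α * s)) (by fun_prop) (.of_forall hg)
    (by
      refine ((((hasDerivAt_id s).const_mul (-α)).exp).const_mul (-(ε * α))).congr_deriv ?_
      simp only [id]
      ring)
    hmin (smul_one_mem_ellipticMatrices hLam)
  simp only [smul_mulVec, one_mulVec, dotProduct_smul, trace_smul, trace_one, smul_eq_mul,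
    Fintype.card_fin, dotProduct_self_eq_norm_sq, ← hs] at htest
  have hbK : inner ℝ (b x₁) (x₁ - y) ≤ K * (2 * d) := by
    refine (real_inner_le_norm _ _).trans (mul_le_mul (hK x₁ ?_) hx₁'.le (norm_nonneg _) hK0)
    have := norm_add_le (x₁ - y) y
    rw [sub_add_cancel] at this
    linarith
  have hsd : d ^ 2 / 4 ≤ s := by
    have := pow_le_pow_left₀ (by positivity) hx₁.le 2
    linarith
  have hαs : Lam * N + 2 * d * K + 1 ≤ 2 * α * Lam * s := by
    have h1 : 2 * α * Lam * (d ^ 2 / 4) = Lam * N + 2 * d * K + 1 := by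
      rw [hα]
      field_simp
      ring
    rw [← h1]
    exact mul_le_mul_of_nonneg_left hsd (by positivity)
  have hfac : 0 < 2 * (ε * α * Real.exp (-α * s)) *
      (2 * α * Lam * s - Lam * N - inner ℝ (b x₁) (x₁ - y)) :=
    mul_pos (by positivity) (by linarith)
  linarith

theorem IsLinearSupersolution.exists_eq_const (hlam : 0 < lam) (hLam : lam ≤ Lam)
    (hv : IsLinearSupersolution lam Lam b v) (hlsc : LowerSemicontinuous v)
    (hb : ∀ R : ℝ, 0 < R → ∃ K : ℝ, ∀ x, ‖x‖ ≤ R → ‖b x‖ ≤ K)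
    (hbdd : ∃ m : ℝ, ∀ x, m ≤ v x)
    (hdrift : ∃ R₀ : ℝ, ∀ x : EuclideanSpace ℝ (Fin N), R₀ ≤ ‖x‖ →
      inner ℝ (b x) x ≤ Lam - lam * ((N : ℝ) - 1)) :
    ∃ c, ∀ x, v x = c := by
  obtain ⟨x₀, hx₀⟩ := hv.exists_forall_le hlam hLam hlsc hbdd hdrift
  exact ⟨v x₀, hv.eq_of_forall_le hlam hLam hlsc hb hx₀⟩

end PucciLiouville


theorem mainTheorem4 (N : ℕ) (lam Lam : ℝ) (hlam : 0 < lam) (hLam : lam ≤ Lam)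
    (A γ : ℝ) (hAγ : (0 < A ∧ 0 < γ) ∨ γ = 2)
    (b : EuclideanSpace ℝ (Fin N) → EuclideanSpace ℝ (Fin N))
    (hb : ∀ R : ℝ, 0 < R → ∃ K : ℝ, 0 < K ∧ ∀ x y : EuclideanSpace ℝ (Fin N),
      ‖x‖ ≤ R → ‖y‖ ≤ R → ‖b x - b y‖ ≤ K * ‖x - y‖)
    (hdrift : ∃ R₀ : ℝ, ∀ x : EuclideanSpace ℝ (Fin N), R₀ ≤ ‖x‖ →
      inner ℝ (b x) x ≤ Lam - lam * ((N : ℝ) - 1))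
    (u : EuclideanSpace ℝ (Fin N) → ℝ)
    (hu : PucciLiouville.IsViscositySupersolution lam Lam b A γ u)
    (hbdd : ∃ m : ℝ, ∀ x : EuclideanSpace ℝ (Fin N), m ≤ u x) :
    ∃ c : ℝ, ∀ x : EuclideanSpace ℝ (Fin N), u x = c := by

  have hbound : ∀ R : ℝ, 0 < R → ∃ K : ℝ, ∀ x, ‖x‖ ≤ R → ‖b x‖ ≤ K := fun R hR => by
    obtain ⟨K, hK, hLip⟩ := hb R hR
    refine ⟨‖b 0‖ + K * R, fun x hx => ?_⟩
    have h1 := hLip x 0 hx (by simpa using hR.le)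
    rw [sub_zero] at h1
    have h2 := norm_le_norm_add_norm_sub' (b x) (b 0)
    have h3 := mul_le_mul_of_nonneg_left hx hK.le
    linarith
  rcases hAγ with ⟨hA, -⟩ | rfl
  · exact (hu.isLinearSupersolution hlam hA.le).exists_eq_const hlam hLam hu.1 hbound hbdd hdrift
  -- The `1` keeps `c` positive when `A = 0`.
  · set c := (|A| + 1) / lam with hc
    have hcpos : 0 < c := by positivity
    have hAc : |A| ≤ c * lam := by
      rw [hc, div_mul_cancel₀ _ hlam.ne']
      linarith
    have hmono : Monotone fun t : ℝ => -Real.exp (-c * t) := fun s t hst => by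
      refine neg_le_neg (Real.exp_le_exp.2 ?_)
      exact mul_le_mul_of_nonpos_left hst (neg_nonpos.2 hcpos.le)
    have hcont : Continuous fun t : ℝ => -Real.exp (-c * t) := by fun_prop
    obtain ⟨m, hm⟩ := hbdd
    obtain ⟨C, hC⟩ := (hu.hopfCole hlam hcpos hAc).exists_eq_const hlam hLam
      (hcont.comp_lowerSemicontinuous hu.1 hmono) hbound ⟨_, fun x => hmono (hm x)⟩ hdrift
    refine ⟨u 0, fun x => ?_⟩
    have h := (hC x).trans (hC 0).symm
    exact mul_left_cancel₀ (neg_ne_zero.2 hcpos.ne') (Real.exp_injective (neg_injective h))
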